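/- Let $n\ge 2$, $p\ge 1$, $k\ge 1$, $z\in\{1,\dots,n-1\}$, $\sigma>0$, $q=(q_1,\dots,q_p)\in(0,1]^p$, and let $\mu^{(1)},\mu^{(2)}\in\mathbb{R}^p$ be such that $\theta:=\mu^{(2)}-\mu^{(1)}\neq 0$ satisfies $\|\theta\|_0:=|\{j:\theta_j\ne 0\}|\le k$. Put $\tau:=n^{-1}\min(z,n-z)$, $\|\theta\|_{2,q}:=\bigl(\sum_{j=1}^p\theta_j^2q_j\bigr)^{1/2}$ and $\theta\circ\sqrt q:=(\theta_1\sqrt{q_1},\dots,\theta_p\sqrt{q_p})^\top$. Let $X=(X_{j,t})\in\mathbb{R}^{p\times n}$ be a random matrix whose columns are independent with $X_t\sim N_p(\mu^{(1)},\sigma^2I_p)$ for $t\le z$ and $X_t\sim N_p(\mu^{(2)},\sigma^2I_p)$ for $t>z$. Let $\Omega=(\omega_{j,t})\in\{0,1\}^{p\times n}$ be independent of $X$, with independent entries $\omega_{j,t}\sim\mathrm{Bern}(q_j)$. Let $X_\Omega:=X\circ\Omega$ be the entrywise product. For $j\in\{1,\dots,p\}$ and $t\in\{1,\dots,n-1\}$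 let $L_{j,t}:=\sum_{r=1}^t\omega_{j,r}$, $R_{j,n-t}:=\sum_{r=t+1}^n\omega_{j,r}$, $N_j:=\sum_{r=1}^n\omega_{j,r}$, and define the MissCUSUM matrix $T_\Omega\in\mathbb{R}^{p\times(n-1)}$ by \[ (T_\Omega)_{j,t}:=\sqrt{\frac{L_{j,t}R_{j,n-t}}{N_j}}\Bigl(\frac1{R_{j,n-t}}\sum_{r=t+1}^n (X_\Omega)_{j,r}-\frac1{L_{j,t}}\sum_{r=1}^t (X_\Omega)_{j,r}\Bigr) \] if $L_{j,t}>0$ and $R_{j,n-t}>0$, and $(T_\Omega)_{j,t}:=0$ otherwise. Let $\lambda\ge 2\sigma\sqrt{n\log(pn)}$, and let $(\hat v,\hat w)$ be any maximiser of \[ \langle T_\Omega,\tilde v\tilde w^\top\rangle-\lambda\|\tilde v\|_1 \] over $\tilde v\in\mathbb{R}^p$, $\tilde w\in\mathbb{R}^{n-1}$ with $\|\tilde v\|_2\le 1$, $\|\tilde w\|_2\le 1$. For non-zero $u,u'\in\mathbb{R}^p$ let $\angle(u,u'):=\cos^{-1}\bigl(|\langle u,u'\rangle|/(\|u\|_2\|u'\|_2)\bigr)$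 be the acute angle between them, and put $\angle(0,u'):=\pi/2$. Then, with probability at least $1-\frac{6}{kn}$, \[ \sin\angle(\hat v,\theta\circ\sqrt q)\le\frac{32\lambda\sqrt k}{n\tau\|\theta\|_{2,q}}+\frac{112\|\theta\|_2}{\tau\|\theta\|_{2,q}}\sqrt{\frac{6\log(kn)}{n}} . \] -/

import Mathlib

open MeasureTheory ProbabilityTheory

noncomputable section

namespace MissInspect

/-- The entrywise product `M ∘ Ω` of a data matrix with a `0/1` revelation matrix. Columns are
indexed by `Fin n`, the index `r` standing for the time `r + 1`. -/
def masked {p n : ℕ} (M : Fin p → Fin n → ℝ) (O : Fin p → Fin n → Bool) : Fin p → Fin n → ℝ :=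
  fun j r => M j r * (if O j r then 1 else 0)

/-- `L_{j,t}`: the number of observed entries in row `j` at the first `t` times. -/
def leftCount {p n : ℕ} (O : Fin p → Fin n → Bool) (j : Fin p) (t : ℕ) : ℝ :=
  ∑ r : Fin n with r.val < t, (if O j r then 1 else 0)

/-- `R_{j,t}`: the number of observed entries in row `j` at the last `t` times. -/
def rightCount {p n : ℕ} (O : Fin p → Fin n → Bool) (j : Fin p) (t : ℕ) : ℝ :=
  ∑ r : Fin n with n - t ≤ r.val, (if O j r then 1 else 0)

/-- The entry in row `j` of the MissCUSUM transformation at the time `t ∈ {1, …, n - 1}`. -/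
def missCUSUMEntry {p n : ℕ} (M : Fin p → Fin n → ℝ) (O : Fin p → Fin n → Bool)
    (j : Fin p) (t : ℕ) : ℝ :=
  if 0 < leftCount O j t ∧ 0 < rightCount O j (n - t) then
    √(leftCount O j t * rightCount O j (n - t) / leftCount O j n) *
      (1 / rightCount O j (n - t) * ∑ r : Fin n with t ≤ r.val, masked M O j r
        - 1 / leftCount O j t * ∑ r : Fin n with r.val < t, masked M O j r)
  else 0

/-- The MissCUSUM transformation; the column index `s` stands for the time `s + 1`. -/
def missCUSUM {p n : ℕ} (M : Fin p → Fin n → ℝ) (O : Fin p → Fin n → Bool) :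
    Fin p → Fin (n - 1) → ℝ :=
  fun j s => missCUSUMEntry M O j (s.val + 1)

/-- The penalised objective `⟨T, v wᵀ⟩ - lam ‖v‖₁`. -/
def objective {p m : ℕ} (T : Fin p → Fin m → ℝ) (lam : ℝ)
    (x : EuclideanSpace ℝ (Fin p) × EuclideanSpace ℝ (Fin m)) : ℝ :=
  ∑ j, ∑ s, T j s * (x.1 j * x.2 s) - lam * ∑ j, |x.1 j|

/-- `(v, w)` maximises the penalised objective over the product of the closed unit balls. -/
def IsArgmax {p m : ℕ} (T : Fin p → Fin m → ℝ) (lam : ℝ)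
    (v : EuclideanSpace ℝ (Fin p)) (w : EuclideanSpace ℝ (Fin m)) : Prop :=
  ‖v‖ ≤ 1 ∧ ‖w‖ ≤ 1 ∧ IsMaxOn (objective T lam) {x | ‖x.1‖ ≤ 1 ∧ ‖x.2‖ ≤ 1} (v, w)

/-- The acute angle between two vectors (equal to `π / 2` if one of them vanishes). -/
def acuteAngle {p : ℕ} (u v : EuclideanSpace ℝ (Fin p)) : ℝ :=
  Real.arccos (|inner ℝ u v| / (‖u‖ * ‖v‖))

/-- The weighted norm `‖u‖_{2,q} = (∑ u_j² q_j)^{1/2}`. -/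
def weightedNorm {p : ℕ} (q : Fin p → unitInterval) (u : EuclideanSpace ℝ (Fin p)) : ℝ :=
  √(∑ j, (u j) ^ 2 * (q j : ℝ))

/-- The vector `θ ∘ √q`. -/
def oracleDirection {p : ℕ} (q : Fin p → unitInterval) (θ : EuclideanSpace ℝ (Fin p)) :
    EuclideanSpace ℝ (Fin p) :=
  WithLp.toLp 2 fun j => θ j * √(q j : ℝ)

/-- The mean matrix with columns `μ₁` at the times `1, …, z` and `μ₂` at the times `z+1, …, n`. -/
def changeMean {p : ℕ} (n z : ℕ) (μ₁ μ₂ : EuclideanSpace ℝ (Fin p)) : Fin p → Fin n → ℝ :=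
  fun j r => if r.val < z then μ₁ j else μ₂ j

/-- The joint law of the data and the revelation matrix: the data entries are independent normal
variables with variance `σ²` and means `changeMean n z μ₁ μ₂` (so the columns are independent
with law `N_p(μ_t, σ² I)`), the revelation indicators in row `j` are Bernoulli with
parameter `q j`, all independent, and the two matrices are independent. -/
def modelLaw {p : ℕ} (n z : ℕ) (μ₁ μ₂ : EuclideanSpace ℝ (Fin p)) (σ : ℝ)
    (q : Fin p → unitInterval) :
    Measure ((Fin p → Fin n → ℝ) × (Fin p → Fin n → Bool)) :=
  (Measure.pi fun j => Measure.pi fun r =>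
      gaussianReal (changeMean n z μ₁ μ₂ j r) (σ ^ 2).toNNReal).prod
    (Measure.pi fun j => Measure.pi fun _ : Fin n => bernoulliMeasure true false (q j))

/-- `τ = n⁻¹ min(z, n - z)`. -/
def changeTau (n z : ℕ) : ℝ := min (z : ℝ) ((n : ℝ) - z) / n

end MissInspect

end

/-! ### Concentration of Gaussian linear forms and of Bernoulli counts. -/

namespace MissInspect

/-! Write `T = a gᵀ + E + B`, where `a = θ ∘ √q`, `g` is the CUSUM of a fully observed unit step,
`E` is the CUSUM of the noise, and `B` is the error from replacing random counts by their means.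

For a fixed mask, each entry of `E` is a linear form in Gaussian noise whose coefficients have
square sum at most 1 (`sum_cusumWeight_sq_le_one`), hence is sub-Gaussian with variance proxy `σ²`.
The signal is a product of ratios of square roots of counts, so `B` is controlled by deviations of
those square roots. The square root stabilises the variance: `sqrt_successCount_tail` holds
uniformly in `q`, and no lower bound on the observation rates is needed. Moreover `B` vanishes
outside the support of `θ`, so only at most `k` rows of counts enter the union bound.

The rest is deterministic. Comparing the objective at the maximiser and at the normalised pair `(a,
g)` bounds the Frobenius distance between the two rank-one matrices, and hence the angle
(`sin_acuteAngle_le_of_isArgmax`). The bound is divided by `‖a‖ ‖g‖`, and `‖g‖` is at least of order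
`n τ` (`le_norm_fullProfileVector`). -/

theorem gaussian_linear_hasSubgaussianMGF {n : ℕ} (μ c : Fin n → ℝ) (V : NNReal)
    (hc : ∑ r, c r ^ 2 ≤ 1) :
    HasSubgaussianMGF (fun x : Fin n → ℝ => ∑ r, c r * (x r - μ r)) V
      (Measure.pi fun r => gaussianReal (μ r) V) := by
  have hind : iIndepFun (fun (r : Fin n) (x : Fin n → ℝ) => c r * (x r - μ r))
      (Measure.pi fun r => gaussianReal (μ r) V) :=
    iIndepFun_pi (X := fun r (x : ℝ) => c r * (x - μ r)) fun r => by fun_prop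
  have hsub : ∀ r ∈ Finset.univ, HasSubgaussianMGF
      (fun x : Fin n → ℝ => c r * (x r - μ r)) (NNReal.mk (c r ^ 2) (sq_nonneg _) * V)
      (Measure.pi fun r => gaussianReal (μ r) V) := by
    intro r _
    refine HasSubgaussianMGF.const_mul ?_ (c r)
    have hmap : (Measure.pi fun r => gaussianReal (μ r) V).map
        (fun x : Fin n → ℝ => x r - μ r) = gaussianReal 0 V := by
      have h1 := (measurePreserving_eval (fun r => gaussianReal (μ r) V) r).map_eq
      have h2 := gaussianReal_map_sub_const (μ := μ r) (v := V) (μ r)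
      rw [← h1, Measure.map_map (by fun_prop) (by fun_prop)] at h2
      simpa [Function.comp_def] using h2
    rw [← HasSubgaussianMGF.id_map_iff (Measurable.aemeasurable (by fun_prop)), hmap]
    refine ⟨fun t => integrable_exp_mul_gaussianReal t, fun t => ?_⟩
    rw [mgf_gaussianReal (μ := 0) (v := V) (by simp)]
    simp
  have hsum := HasSubgaussianMGF.sum_of_iIndepFun hind hsub
  refine ⟨hsum.integrable_exp_mul, fun t => (hsum.mgf_le t).trans ?_⟩
  gcongr
  rw [← NNReal.coe_le_coe]
  simp only [NNReal.coe_sum, NNReal.coe_mul, NNReal.coe_mk]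
  rw [← Finset.sum_mul]
  exact mul_le_of_le_one_left V.2 hc

theorem gaussian_linear_tail {n : ℕ} (μ c : Fin n → ℝ) (V : NNReal)
    (hc : ∑ r, c r ^ 2 ≤ 1) {u : ℝ} (hu : 0 ≤ u) :
    (Measure.pi fun r => gaussianReal (μ r) V).real {x | u < |∑ r, c r * (x r - μ r)|} ≤
      2 * Real.exp (-u ^ 2 / (2 * V)) := by
  have h := gaussian_linear_hasSubgaussianMGF μ c V hc
  have h1 := h.measure_ge_le hu
  have h2 := h.neg.measure_ge_le hu
  rw [two_mul]
  refine le_trans (le_trans (measureReal_mono ?_) (measureReal_union_le _ _)) (add_le_add h1 h2)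
  intro x hx
  rcases lt_abs.1 (show u < |_| from hx) with h | h
  · exact Or.inl h.le
  · exact Or.inr h.le

/-- The number of successes with index in `A`, with real values. -/
noncomputable def successCount {n : ℕ} (A : Finset (Fin n)) (x : Fin n → Bool) : ℝ :=
  ∑ r ∈ A, (if x r then 1 else 0)

theorem successCount_nonneg {n : ℕ} (A : Finset (Fin n)) (x : Fin n → Bool) :
    0 ≤ successCount A x :=
  Finset.sum_nonneg fun r _ => by split_ifs <;> norm_num

/-- By `1 + y ≤ exp y`, a Bernoulli variable is dominated by a Poisson variable of the same mean, so
counts obey Poisson Chernoff bounds. -/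
theorem mgf_bernoulli_le (q : unitInterval) (t : ℝ) :
    mgf (fun b : Bool => if b then (1 : ℝ) else 0) (bernoulliMeasure true false q) t ≤
      Real.exp (q * (Real.exp t - 1)) := by
  have : mgf (fun b : Bool => if b then (1 : ℝ) else 0) (bernoulliMeasure true false q) t =
      q * Real.exp t + (1 - q) := by
    rw [mgf, integral_bernoulliMeasure]
    simp
  rw [this]
  have := Real.add_one_le_exp ((q : ℝ) * (Real.exp t - 1))
  linarith

theorem mgf_successCount_le {n : ℕ} (q : unitInterval) (A : Finset (Fin n)) (t : ℝ) :
    mgf (successCount A) (Measure.pi fun _ : Fin n => bernoulliMeasure true false q) t ≤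
      Real.exp (A.card * q * (Real.exp t - 1)) := by
  have hind : iIndepFun (fun (r : Fin n) (x : Fin n → Bool) => if x r then (1 : ℝ) else 0)
      (Measure.pi fun _ : Fin n => bernoulliMeasure true false q) :=
    iIndepFun_pi (X := fun r (b : Bool) => if b then (1 : ℝ) else 0)
      fun r => (measurable_of_countable _).aemeasurable
  have hsum := hind.mgf_sum (t := t) (fun r => measurable_of_countable _) A
  have hfun : successCount A = ∑ r ∈ A, fun x : Fin n → Bool => if x r then (1 : ℝ) else 0 := by
    ext x; simp [successCount]
  rw [hfun, hsum]
  have : ∀ r ∈ A, mgf (fun x : Fin n → Bool => if x r then (1 : ℝ) else 0)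
      (Measure.pi fun _ : Fin n => bernoulliMeasure true false q) t ≤
        Real.exp (q * (Real.exp t - 1)) := by
    intro r _
    refine le_trans (le_of_eq ?_) (mgf_bernoulli_le q t)
    have h1 := (measurePreserving_eval (fun _ : Fin n => bernoulliMeasure true false q) r).map_eq
    conv_rhs => rw [← h1]
    exact (mgf_map (X := fun b : Bool => if b then (1 : ℝ) else 0)
      (Y := fun x : Fin n → Bool => x r) (measurable_of_countable _).aemeasurable
      (measurable_of_countable _).aestronglyMeasurable).symm
  refine (Finset.prod_le_prod (fun r _ => mgf_nonneg) this).trans ?_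
  rw [Finset.prod_const, ← Real.exp_nat_mul, mul_assoc]

/-- The Kullback–Leibler divergence between Poisson laws dominates the squared Hellinger
distance. -/
theorem sq_sqrt_sub_sqrt_le {a m : ℝ} (ha : 0 < a) (hm : 0 < m) :
    (√a - √m) ^ 2 ≤ a * Real.log (a / m) - a + m := by
  -- The inequality `log y ≤ y - 1` at `y = √m / √a` gives `a log (a / m) ≥ 2a - 2√(am)`.
  have h1 := Real.log_le_sub_one_of_pos (div_pos (Real.sqrt_pos.2 hm) (Real.sqrt_pos.2 ha))
  have h2 : Real.log (a / m) = -2 * Real.log (√m / √a) := by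
    rw [Real.log_div ha.ne' hm.ne', Real.log_div (Real.sqrt_pos.2 hm).ne' (Real.sqrt_pos.2 ha).ne',
      Real.log_sqrt hm.le, Real.log_sqrt ha.le]
    ring
  have h3 : a * (√m / √a) = √a * √m := by
    nth_rewrite 1 [← Real.mul_self_sqrt ha.le]
    have := (Real.sqrt_pos.2 ha).ne'
    field_simp
  rw [h2]
  nlinarith [Real.sq_sqrt ha.le, Real.sq_sqrt hm.le, mul_le_mul_of_nonneg_left h1 ha.le]

/-- `log (a / m)` is the optimal Poisson tilt. Its sign is that of `a - m`, so one estimate serves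
both tails. -/
theorem successCount_chernoff {n : ℕ} (q : unitInterval) (A : Finset (Fin n))
    {a m : ℝ} (hm : m = A.card * q) (hm0 : 0 < m) (ha : 0 < a) :
    Real.exp (-Real.log (a / m) * a) *
      mgf (successCount A) (Measure.pi fun _ : Fin n => bernoulliMeasure true false q)
        (Real.log (a / m)) ≤ Real.exp (-(√a - √m) ^ 2) := by
  have h := mgf_successCount_le q A (Real.log (a / m))
  rw [← hm, Real.exp_log (div_pos ha hm0)] at h
  refine (mul_le_mul_of_nonneg_left h (Real.exp_pos _).le).trans ?_
  rw [← Real.exp_add, Real.exp_le_exp]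
  have := sq_sqrt_sub_sqrt_le ha hm0
  have h2 : m * (a / m - 1) = a - m := by field_simp
  rw [h2]
  linarith

theorem sqrt_successCount_tail {n : ℕ} (q : unitInterval) (hq : 0 < q) {A : Finset (Fin n)}
    (hA : A.Nonempty) {x : ℝ} (hx : 0 ≤ x) :
    (Measure.pi fun _ : Fin n => bernoulliMeasure true false q).real
      {ω | x < |√(successCount A ω) - √(A.card * q)|} ≤ 2 * Real.exp (-x ^ 2) := by
  set μ := Measure.pi fun _ : Fin n => bernoulliMeasure true false q
  obtain ⟨m, hm⟩ : ∃ m : ℝ, m = A.card * q := ⟨_, rfl⟩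
  have hm0 : 0 < m := by
    rw [hm]
    exact mul_pos (by exact_mod_cast hA.card_pos) (by exact_mod_cast hq)
  rw [← hm]
  have hint : ∀ t, Integrable (fun ω => Real.exp (t * successCount A ω)) μ :=
    fun t => Integrable.of_finite
  have hup : μ.real {ω | (√m + x) ^ 2 ≤ successCount A ω} ≤ Real.exp (-x ^ 2) := by
    have ha : 0 < (√m + x) ^ 2 := by have := Real.sqrt_pos.2 hm0; positivity
    refine (measure_ge_le_exp_mul_mgf _ (Real.log_nonneg ?_) (hint (Real.log _))).trans
      ((successCount_chernoff q A hm hm0 ha).trans_eq ?_)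
    · rw [le_div_iff₀ hm0]
      nlinarith [Real.sq_sqrt hm0.le, Real.sqrt_nonneg m]
    · rw [Real.sqrt_sq (by positivity)]
      ring_nf
  have hlow : μ.real {ω | √(successCount A ω) < √m - x} ≤ Real.exp (-x ^ 2) := by
    -- For `x ≥ √m` the event is empty; otherwise the threshold `(√m - x) ^ 2` is positive and its
    -- logarithm is usable.
    rcases le_or_gt (√m) x with h | h
    · have : {ω | √(successCount A ω) < √m - x} = ∅ := by
        ext ω
        simp only [Set.mem_ofPred_eq, Set.mem_empty_iff_false, iff_false, not_lt]
        linarith [Real.sqrt_nonneg (successCount A ω)]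
      rw [this]
      simp [Real.exp_nonneg]
    · have ha : 0 < (√m - x) ^ 2 := by have := sub_pos.2 h; positivity
      refine le_trans (measureReal_mono (s₂ := {ω | successCount A ω ≤ (√m - x) ^ 2}) ?_)
        ((measure_le_le_exp_mul_mgf _ (Real.log_nonpos ?_ ?_) (hint (Real.log _))).trans
        ((successCount_chernoff q A hm hm0 ha).trans_eq ?_))
      · intro ω hω
        exact (Real.sqrt_le_left (sub_pos.2 h).le).1 (le_of_lt hω)
      · positivity
      · rw [div_le_iff₀ hm0]
        nlinarith [Real.sq_sqrt hm0.le, Real.sqrt_nonneg m]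
      · rw [Real.sqrt_sq (sub_pos.2 h).le]
        ring_nf
  rw [two_mul]
  refine le_trans (le_trans (measureReal_mono ?_) (measureReal_union_le _ _)) (add_le_add hup hlow)
  intro ω hω
  rcases lt_abs.1 (show x < |_| from hω) with h | h
  · left
    have : √m + x ≤ √(successCount A ω) := by linarith
    exact (Real.le_sqrt (by positivity) (successCount_nonneg _ _)).1 this
  · right
    show √(successCount A ω) < √m - x
    linarith

end MissInspect

/-! ### Perturbation of a rank-one matrix under an `ℓ₁` penalty. -/

namespace MissInspect

theorem sum_mul_le_sqrt_mul_sqrt_of_sq_le {ι : Type*} (s : Finset ι) (f g : ι → ℝ) {a b : ℝ}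
    (ha : 0 ≤ a) (hf : ∑ i ∈ s, f i ^ 2 ≤ a ^ 2) (hg : ∑ i ∈ s, g i ^ 2 ≤ b) :
    ∑ i ∈ s, f i * g i ≤ a * √b := by
  refine (Real.sum_mul_le_sqrt_mul_sqrt s f g).trans ?_
  gcongr
  exact Real.sqrt_le_left ha |>.2 hf

theorem EuclideanSpace.sum_sq {m : ℕ} (x : EuclideanSpace ℝ (Fin m)) :
    ∑ i, x i ^ 2 = ‖x‖ ^ 2 := by
  rw [EuclideanSpace.norm_sq_eq]
  simp

theorem EuclideanSpace.sum_mul {m : ℕ} (x y : EuclideanSpace ℝ (Fin m)) :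
    ∑ i, x i * y i = inner ℝ x y := by
  simp [PiLp.inner_apply, mul_comm]

/-- The cosine `C` of the angle is at least `1 - x`, and `1 - C² ≤ 2 (1 - C)`. In the application
`c` is the inner product of the right vectors. -/
theorem sin_acuteAngle_le {p : ℕ} {v u : EuclideanSpace ℝ (Fin p)} (hv : ‖v‖ ≤ 1) (hu : ‖u‖ = 1)
    {c x : ℝ} (hc : |c| ≤ 1) (hx : 1 - inner ℝ u v * c = x) :
    Real.sin (acuteAngle v u) ≤ √(2 * x) := by
  have hcos : 1 - x ≤ |inner ℝ v u| / (‖v‖ * ‖u‖) := by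
    rw [← hx, hu, mul_one, sub_sub_cancel, real_inner_comm]
    rcases (norm_nonneg v).eq_or_lt with h | h
    · have : v = 0 := norm_eq_zero.1 h.symm
      simp [this]
    · calc inner ℝ v u * c ≤ |inner ℝ v u * c| := le_abs_self _
        _ = |inner ℝ v u| * |c| := abs_mul _ _
        _ ≤ |inner ℝ v u| * 1 := by gcongr
        _ ≤ |inner ℝ v u| / ‖v‖ := by
          rw [mul_one, le_div_iff₀ h]
          exact mul_le_of_le_one_right (abs_nonneg _) hv
  rw [acuteAngle, Real.sin_arccos]
  apply Real.sqrt_le_sqrt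
  have h0 : 0 ≤ |inner ℝ v u| / (‖v‖ * ‖u‖) := by positivity
  nlinarith [sq_nonneg (1 - |inner ℝ v u| / (‖v‖ * ‖u‖))]

theorem acuteAngle_smul_right {p : ℕ} (v u : EuclideanSpace ℝ (Fin p)) {c : ℝ} (hc : 0 < c) :
    acuteAngle v (c • u) = acuteAngle v u := by
  unfold acuteAngle
  rw [inner_smul_right, norm_smul, abs_mul, Real.norm_of_nonneg hc.le, abs_of_pos hc,
    mul_left_comm, mul_div_mul_left _ _ hc.ne']

section Perturbation

variable {p m : ℕ} {v u : EuclideanSpace ℝ (Fin p)} {w g : EuclideanSpace ℝ (Fin m)}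

theorem sum_sq_outer_sub_outer_le (hv : ‖v‖ ≤ 1) (hw : ‖w‖ ≤ 1) (hu : ‖u‖ = 1) (hg : ‖g‖ = 1) :
    ∑ j, ∑ s, (v j * w s - u j * g s) ^ 2 ≤ 2 * (1 - inner ℝ u v * inner ℝ g w) := by
  have h1 : ∑ j, ∑ s, (v j * w s - u j * g s) ^ 2 =
      (∑ j, v j ^ 2) * (∑ s, w s ^ 2) - 2 * ((∑ j, u j * v j) * (∑ s, g s * w s)) +
        (∑ j, u j ^ 2) * (∑ s, g s ^ 2) := by
    simp only [Finset.sum_mul_sum]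
    simp only [Finset.mul_sum, ← Finset.sum_sub_distrib, ← Finset.sum_add_distrib]
    refine Finset.sum_congr rfl fun j _ => Finset.sum_congr rfl fun s _ => by ring
  rw [h1]
  simp only [EuclideanSpace.sum_sq, EuclideanSpace.sum_mul, hu, hg]
  have : ‖v‖ ^ 2 * ‖w‖ ^ 2 ≤ 1 := by
    rw [← mul_pow]
    exact pow_le_one₀ (by positivity) (mul_le_one₀ hv (norm_nonneg _) hw)
  linarith

theorem abs_sub_abs_mul_norm_le (hg : ‖g‖ = 1) (a b : ℝ) :
    |a| - |b| * ‖w‖ ≤ √(∑ s, (b * w s - a * g s) ^ 2) := by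
  have h : √(∑ s, (b * w s - a * g s) ^ 2) = ‖b • w - a • g‖ := by
    rw [EuclideanSpace.norm_eq]
    simp
  rw [h, norm_sub_rev]
  refine le_trans (le_of_eq ?_) (norm_sub_norm_le _ _)
  simp [norm_smul, hg]

/-- Perturbation of the leading left singular vector under an `ℓ₁` penalty, unit-vector form. -/
theorem sin_acuteAngle_le_of_isArgmax_unit (T E B : Fin p → Fin m → ℝ) {D lam kap b : ℝ} {k : ℕ}
    (hD : 0 < D) (hlam : 0 ≤ lam) (hkap : 0 ≤ kap) (hb : 0 ≤ b) (hu : ‖u‖ = 1) (hg : ‖g‖ = 1)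
    (hT : ∀ j s, T j s = D * (u j * g s) + E j s + B j s)
    (hk : (Finset.univ.filter fun j => u j ≠ 0).card ≤ k)
    (hE : ∀ j, ∑ s, E j s ^ 2 ≤ kap ^ 2)
    (hkl : kap ≤ lam ∨ kap * √p ≤ 2 * (lam * √k))
    (hB : ∑ j, ∑ s, B j s ^ 2 ≤ b ^ 2)
    (hvw : IsArgmax T lam v w) :
    Real.sin (acuteAngle v u) ≤ 2 * (3 * (lam * √k) + b) / D := by
  obtain ⟨hv, hw, hmax⟩ := hvw
  set x := 1 - inner ℝ u v * inner ℝ g w with hx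
  have hgw : |inner ℝ g w| ≤ 1 := by
    refine (abs_real_inner_le_norm g w).trans ?_
    rwa [hg, one_mul]
  refine (sin_acuteAngle_le hv hu hgw hx.symm).trans ?_
  set Y : Fin p → Fin m → ℝ := fun j s => v j * w s - u j * g s with hY
  set y : Fin p → ℝ := fun j => √(∑ s, Y j s ^ 2) with hy
  have hy0 : ∀ j, 0 ≤ y j := fun j => Real.sqrt_nonneg _
  have hysq : ∑ j, y j ^ 2 ≤ 2 * x := by
    refine le_trans (le_of_eq ?_) (sum_sq_outer_sub_outer_le hv hw hu hg)
    refine Finset.sum_congr rfl fun j _ => Real.sq_sqrt (Finset.sum_nonneg fun s _ => sq_nonneg _)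
  have hx0 : 0 ≤ 2 * x := (Finset.sum_nonneg fun j _ => sq_nonneg _).trans hysq
  set S := Finset.univ.filter fun j => u j ≠ 0 with hS
  have hmax' := hmax (show (u, g) ∈ _ from ⟨hu.le, hg.le⟩)
  simp only [Set.mem_ofPred_eq, objective] at hmax'
  -- The signal part loses exactly `D * x`, because `⟨u gᵀ, v wᵀ - u gᵀ⟩ = -x` for unit `u` and `g`.
  have hsplit : ∑ j, ∑ s, T j s * (v j * w s) - ∑ j, ∑ s, T j s * (u j * g s) =
      -(D * x) + ∑ j, ∑ s, E j s * Y j s + ∑ j, ∑ s, B j s * Y j s := by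
    have h1 : ∑ j, ∑ s, (u j * g s) * Y j s = -x := by
      have : ∑ j, ∑ s, (u j * g s) * Y j s = (∑ j, u j * v j) * (∑ s, g s * w s)
          - (∑ j, u j ^ 2) * (∑ s, g s ^ 2) := by
        simp only [Finset.sum_mul_sum, ← Finset.sum_sub_distrib]
        refine Finset.sum_congr rfl fun j _ => Finset.sum_congr rfl fun s _ => by
          simp only [hY]; ring
      rw [this]
      simp only [EuclideanSpace.sum_sq, EuclideanSpace.sum_mul, hu, hg, hx]
      ring
    rw [← mul_neg, ← h1]
    simp only [Finset.mul_sum, ← Finset.sum_sub_distrib, ← Finset.sum_add_distrib]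
    refine Finset.sum_congr rfl fun j _ => Finset.sum_congr rfl fun s _ => by
      rw [hT]; simp only [hY]; ring
  have hBY : ∑ j, ∑ s, B j s * Y j s ≤ b * √(2 * x) := by
    rw [← Finset.sum_product']
    apply sum_mul_le_sqrt_mul_sqrt_of_sq_le _ (fun i : Fin p × Fin m => B i.1 i.2)
      (fun i : Fin p × Fin m => Y i.1 i.2) hb
    · rw [Finset.sum_product]; exact hB
    · rw [Finset.sum_product]; exact sum_sq_outer_sub_outer_le hv hw hu hg
  have hEY : ∀ j, ∑ s, E j s * Y j s ≤ kap * y j := fun j =>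
    sum_mul_le_sqrt_mul_sqrt_of_sq_le _ _ _ hkap (hE j) le_rfl
  have hsumS : ∑ j ∈ S, y j ≤ √k * √(2 * x) := by
    have := sum_mul_le_sqrt_mul_sqrt_of_sq_le S (fun _ => 1) y (a := √k) (b := 2 * x)
      (Real.sqrt_nonneg _) (by
        rw [Real.sq_sqrt (Nat.cast_nonneg _)]
        simpa using hk) ((Finset.sum_le_sum_of_subset_of_nonneg (Finset.subset_univ _)
          fun j _ _ => sq_nonneg _).trans hysq)
    simpa using this
  have hl1 : ∀ j, |u j| - |v j| ≤ y j := fun j => by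
    refine le_trans ?_ (abs_sub_abs_mul_norm_le (w := w) hg (u j) (v j))
    have := mul_le_of_le_one_right (abs_nonneg (v j)) hw
    linarith
  have hmain : ∑ j, ∑ s, E j s * Y j s + lam * ∑ j, (|u j| - |v j|) ≤
      3 * (lam * √k) * √(2 * x) := by
    rw [Finset.mul_sum]
    have hnotS : ∀ j, j ∉ S → u j = 0 := fun j hj => by simpa [hS] using hj
    rcases hkl with h | h
    -- Off `S` the row of `Y` is `v j • w`, of norm at most `|v j|`, so the penalty absorbs the
    -- noise. On `S`, noise and penalty each cost at most `lam * y j`.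
    · have : ∀ j, ∑ s, E j s * Y j s + lam * (|u j| - |v j|) ≤
          if j ∈ S then 2 * lam * y j else 0 := by
        intro j
        have h1 : ∑ s, E j s * Y j s ≤ lam * y j :=
          (hEY j).trans (mul_le_mul_of_nonneg_right h (hy0 j))
        split_ifs with hj
        · have := mul_le_mul_of_nonneg_left (hl1 j) hlam
          linarith
        · have hyj : y j ≤ |v j| := by
            have : y j = |v j| * ‖w‖ := by
              simp only [hy, hY, hnotS j hj, zero_mul, sub_zero, mul_pow, ← Finset.mul_sum,
                EuclideanSpace.sum_sq]
              rw [← mul_pow, Real.sqrt_sq_eq_abs, abs_mul, abs_norm]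
            rw [this]
            exact mul_le_of_le_one_right (abs_nonneg _) hw
          rw [hnotS j hj, abs_zero]
          have := mul_le_mul_of_nonneg_left hyj hlam
          linarith
      rw [← Finset.sum_add_distrib]
      refine (Finset.sum_le_sum fun j _ => this j).trans ?_
      rw [← Finset.sum_filter, Finset.filter_mem_eq_inter, Finset.univ_inter, ← Finset.mul_sum]
      have h2 := mul_le_mul_of_nonneg_left hsumS hlam
      have h3 : 0 ≤ lam * (√k * √(2 * x)) := by positivity
      linarith
    -- Here the noise may exceed the penalty level. Cauchy–Schwarz over all `p` rows costs `2 * (lam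
    -- * √k)`, and the penalty one more `lam * √k`.
    · have h1 : ∑ j, ∑ s, E j s * Y j s ≤ 2 * (lam * √k) * √(2 * x) := by
        have hsum : ∑ j, y j ≤ √p * √(2 * x) := by
          simpa using sum_mul_le_sqrt_mul_sqrt_of_sq_le Finset.univ (fun _ => 1) y (a := √p)
            (b := 2 * x) (Real.sqrt_nonneg _) (by simp [Real.sq_sqrt]) hysq
        calc ∑ j, ∑ s, E j s * Y j s ≤ ∑ j, kap * y j := Finset.sum_le_sum fun j _ => hEY j
          _ = kap * ∑ j, y j := by rw [Finset.mul_sum]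
          _ ≤ kap * (√p * √(2 * x)) := by gcongr
          _ = kap * √p * √(2 * x) := by ring
          _ ≤ _ := by gcongr
      have h2 : ∑ j, lam * (|u j| - |v j|) ≤ lam * √k * √(2 * x) := by
        have : ∀ j, lam * (|u j| - |v j|) ≤ if j ∈ S then lam * y j else 0 := by
          intro j
          split_ifs with hj
          · exact mul_le_mul_of_nonneg_left (hl1 j) hlam
          · rw [hnotS j hj, abs_zero]
            have := mul_nonneg hlam (abs_nonneg (v j))
            linarith
        refine (Finset.sum_le_sum fun j _ => this j).trans ?_
        rw [← Finset.sum_filter, Finset.filter_mem_eq_inter, Finset.univ_inter, ← Finset.mul_sum,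
          mul_assoc]
        exact mul_le_mul_of_nonneg_left hsumS hlam
      linarith
  rw [Finset.sum_sub_distrib, mul_sub] at hmain
  have hfin : D * x ≤ (3 * (lam * √k) + b) * √(2 * x) := by linarith
  rw [le_div_iff₀ hD]
  -- Since `x = √(2x)² / 2`, cancelling one `√(2x)` produces the factor 2; a vanishing root is
  -- treated apart.
  have hsq := Real.mul_self_sqrt hx0
  rcases (Real.sqrt_nonneg (2 * x)).eq_or_lt with h | h
  · rw [← h, zero_mul]; positivity
  · refine le_of_mul_le_mul_right ?_ h
    nlinarith

/-- Perturbation of the leading left singular vector of `a gᵀ` under an `ℓ₁` penalty. -/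
theorem sin_acuteAngle_le_of_isArgmax (T E B : Fin p → Fin m → ℝ)
    {a : EuclideanSpace ℝ (Fin p)} {lam kap b : ℝ} {k : ℕ}
    (hlam : 0 ≤ lam) (hkap : 0 ≤ kap) (hb : 0 ≤ b) (ha : a ≠ 0) (hg : g ≠ 0)
    (hT : ∀ j s, T j s = a j * g s + E j s + B j s)
    (hk : (Finset.univ.filter fun j => a j ≠ 0).card ≤ k)
    (hE : ∀ j, ∑ s, E j s ^ 2 ≤ kap ^ 2)
    (hkl : kap ≤ lam ∨ kap * √p ≤ 2 * (lam * √k))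
    (hB : ∑ j, ∑ s, B j s ^ 2 ≤ b ^ 2)
    (hvw : IsArgmax T lam v w) :
    Real.sin (acuteAngle v a) ≤ 2 * (3 * (lam * √k) + b) / (‖a‖ * ‖g‖) := by
  have ha' := norm_pos_iff.2 ha
  have hg' := norm_pos_iff.2 hg
  rw [← acuteAngle_smul_right v a (inv_pos.2 ha')]
  refine sin_acuteAngle_le_of_isArgmax_unit (g := ‖g‖⁻¹ • g) T E B (by positivity) hlam hkap hb
    (by rw [norm_smul, norm_inv, norm_norm, inv_mul_cancel₀ ha'.ne'])
    (by rw [norm_smul, norm_inv, norm_norm, inv_mul_cancel₀ hg'.ne']) (fun j s => ?_) ?_ hE hkl hB hvw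
  · rw [hT]
    simp only [PiLp.smul_apply, smul_eq_mul]
    field_simp
  · simpa [ha] using hk

end Perturbation

end MissInspect

/-! ### The CUSUM as a linear form, and the profile of a step. -/

namespace MissInspect

/-- The indices of the first `t` times. -/
def leftSet (n t : ℕ) : Finset (Fin n) := Finset.univ.filter fun r => r.val < t

/-- The indices of the times after `t`. -/
def rightSet (n t : ℕ) : Finset (Fin n) := Finset.univ.filter fun r => t ≤ r.val

theorem card_leftSet {n t : ℕ} (ht : t ≤ n) : (leftSet n t).card = t := by
  simp [leftSet, Fin.card_filter_val_lt, ht]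

theorem card_rightSet {n t : ℕ} (ht : t ≤ n) : (rightSet n t).card = n - t := by
  have h := Finset.card_filter_add_card_filter_not (s := (Finset.univ : Finset (Fin n)))
    (fun r => r.val < t)
  simp only [not_lt, Finset.card_univ, Fintype.card_fin] at h
  have h2 := card_leftSet ht
  unfold leftSet at h2
  unfold rightSet
  omega

theorem sum_leftSet_add_sum_rightSet {n : ℕ} (t : ℕ) (f : Fin n → ℝ) :
    ∑ r ∈ leftSet n t, f r + ∑ r ∈ rightSet n t, f r = ∑ r, f r := by
  rw [← Finset.sum_filter_add_sum_filter_not Finset.univ (fun r : Fin n => r.val < t)]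
  simp [leftSet, rightSet]

theorem leftCount_eq {p n : ℕ} (O : Fin p → Fin n → Bool) (j : Fin p) (t : ℕ) :
    leftCount O j t = successCount (leftSet n t) (O j) := rfl

theorem rightCount_eq {p n t : ℕ} (ht : t ≤ n) (O : Fin p → Fin n → Bool) (j : Fin p) :
    rightCount O j (n - t) = successCount (rightSet n t) (O j) := by
  unfold rightCount successCount rightSet
  rw [Nat.sub_sub_self ht]

theorem successCount_mono {n : ℕ} {A B : Finset (Fin n)} (h : A ⊆ B) (ω : Fin n → Bool) :
    successCount A ω ≤ successCount B ω :=
  Finset.sum_le_sum_of_subset_of_nonneg h fun r _ _ => by split_ifs <;> norm_num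

theorem successCount_left_add_right {n : ℕ} (t : ℕ) (ω : Fin n → Bool) :
    successCount (leftSet n t) ω + successCount (rightSet n t) ω =
      successCount (leftSet n n) ω := by
  unfold successCount
  rw [sum_leftSet_add_sum_rightSet]
  simp [leftSet]

/-- The coefficients of the MissCUSUM transformation, as a linear form in a row of the data. -/
noncomputable def cusumWeight {n : ℕ} (ω : Fin n → Bool) (t : ℕ) (r : Fin n) : ℝ :=
  if 0 < successCount (leftSet n t) ω ∧ 0 < successCount (rightSet n t) ω then
    √(successCount (leftSet n t) ω * successCount (rightSet n t) ω / successCount (leftSet n n) ω) *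
      ((if r.val < t then -(successCount (leftSet n t) ω)⁻¹ else (successCount (rightSet n t) ω)⁻¹) *
        (if ω r then 1 else 0))
  else 0

theorem sum_split_mul {n : ℕ} (t : ℕ) (a b : ℝ) (f : Fin n → ℝ) :
    ∑ r : Fin n, (if r.val < t then a else b) * f r =
      a * ∑ r ∈ leftSet n t, f r + b * ∑ r ∈ rightSet n t, f r := by
  rw [← sum_leftSet_add_sum_rightSet t, Finset.mul_sum, Finset.mul_sum]
  congr 1
  · refine Finset.sum_congr rfl fun r hr => ?_
    rw [if_pos (by simpa [leftSet] using hr)]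
  · refine Finset.sum_congr rfl fun r hr => ?_
    rw [if_neg (by simpa [rightSet] using hr)]

theorem missCUSUMEntry_eq_sum {p n t : ℕ} (ht : t ≤ n) (M : Fin p → Fin n → ℝ)
    (O : Fin p → Fin n → Bool) (j : Fin p) :
    missCUSUMEntry M O j t = ∑ r, cusumWeight (O j) t r * M j r := by
  unfold missCUSUMEntry cusumWeight
  simp only [leftCount_eq, rightCount_eq ht]
  split_ifs with h
  · simp only [mul_assoc, ← Finset.mul_sum]
    rw [sum_split_mul]
    congr 1
    simp only [masked, leftSet, rightSet, one_div, mul_comm (M j _)]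
    ring
  · simp

/-- When both counts are positive the sum is `(L R / N) (1 / L + 1 / R) = 1`. -/
theorem sum_cusumWeight_sq_le_one {n : ℕ} (t : ℕ) (ω : Fin n → Bool) :
    ∑ r, cusumWeight ω t r ^ 2 ≤ 1 := by
  unfold cusumWeight
  split_ifs with h
  · obtain ⟨hL, hR⟩ := h
    have hN := successCount_left_add_right t ω
    have h1 : ∀ r : Fin n, ((if r.val < t then -(successCount (leftSet n t) ω)⁻¹
        else (successCount (rightSet n t) ω)⁻¹) * (if ω r then 1 else 0)) ^ 2 =
        (if r.val < t then ((successCount (leftSet n t) ω)⁻¹) ^ 2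
        else ((successCount (rightSet n t) ω)⁻¹) ^ 2) * (if ω r then 1 else 0) := by
      intro r
      split_ifs <;> simp
    simp only [mul_pow _ _ 2, ← Finset.mul_sum] at h1 ⊢
    simp only [h1]
    rw [sum_split_mul, Real.sq_sqrt (by rw [← hN]; positivity), ← hN]
    change _ * (_ * successCount (leftSet n t) ω + _ * successCount (rightSet n t) ω) ≤ 1
    apply le_of_eq
    field_simp
    ring
  · simp

theorem missCUSUM_masked {p n : ℕ} (M : Fin p → Fin n → ℝ) (O : Fin p → Fin n → Bool) :
    missCUSUM (masked M O) O = missCUSUM M O := by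
  have : masked (masked M O) O = masked M O := by
    ext j r
    unfold masked
    split_ifs <;> simp
  unfold missCUSUM missCUSUMEntry
  rw [this]

/-- The CUSUM of a unit step, as a function of counts. -/
noncomputable def stepProfile (l N m r : ℝ) : ℝ := √l / √N * (√m / √r) * √m

theorem sqrt_mul_div_eq_stepProfile {L R N m : ℝ} (hL : 0 < L) (hR : 0 < R) (hN : 0 < N)
    (hm : 0 ≤ m) : √(L * R / N) * (R⁻¹ * m) = stepProfile L N m R := by
  unfold stepProfile
  rw [Real.sqrt_div (by positivity), Real.sqrt_mul hL.le]
  have h1 := (Real.sqrt_pos.2 hR).ne'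
  have h2 := (Real.sqrt_pos.2 hN).ne'
  nth_rewrite 2 [← Real.mul_self_sqrt hR.le]
  nth_rewrite 1 [← Real.mul_self_sqrt hm]
  field_simp

/-- For `t ≤ z` the left average is `μ₁ j` and the right average exceeds it by `θ j` times the
fraction of right observations lying after `z`; the other case is its mirror image. If one side is
empty, both expressions vanish, using `y / 0 = 0`. -/
theorem sum_cusumWeight_changeMean {p n : ℕ} (z t : ℕ)
    (μ₁ μ₂ : EuclideanSpace ℝ (Fin p)) (ω : Fin n → Bool) (j : Fin p) :
    ∑ r, cusumWeight ω t r * changeMean n z μ₁ μ₂ j r =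
      (μ₂ j - μ₁ j) * if t ≤ z then
        stepProfile (successCount (leftSet n t) ω) (successCount (leftSet n n) ω)
          (successCount (rightSet n z) ω) (successCount (rightSet n t) ω)
      else stepProfile (successCount (rightSet n t) ω) (successCount (leftSet n n) ω)
          (successCount (leftSet n z) ω) (successCount (leftSet n t) ω) := by
  have hN := successCount_left_add_right t ω
  have hLz := successCount_nonneg (leftSet n z) ω
  have hRz := successCount_nonneg (rightSet n z) ω
  unfold cusumWeight
  by_cases h : 0 < successCount (leftSet n t) ω ∧ 0 < successCount (rightSet n t) ω
  · simp only [if_pos h, mul_assoc, ← Finset.mul_sum]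
    rw [sum_split_mul]
    obtain ⟨hL, hR⟩ := h
    split_ifs with htz
    · have h1 : ∑ r ∈ leftSet n t, (if ω r then 1 else 0) * changeMean n z μ₁ μ₂ j r =
          μ₁ j * successCount (leftSet n t) ω := by
        rw [successCount, Finset.mul_sum]
        refine Finset.sum_congr rfl fun r hr => ?_
        have hr' : r.val < t := by simpa [leftSet] using hr
        rw [changeMean, if_pos (hr'.trans_le htz), mul_comm]
      have h2 : ∑ r ∈ rightSet n t, (if ω r then 1 else 0) * changeMean n z μ₁ μ₂ j r =
          μ₁ j * successCount (rightSet n t) ω +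
            (μ₂ j - μ₁ j) * successCount (rightSet n z) ω := by
        have h3 : rightSet n z = (rightSet n t).filter fun r => z ≤ r.val := by
          ext r
          simp only [rightSet, Finset.mem_filter, Finset.mem_univ, true_and]
          omega
        rw [h3, successCount, successCount, Finset.sum_filter, Finset.mul_sum, Finset.mul_sum,
          ← Finset.sum_add_distrib]
        refine Finset.sum_congr rfl fun r hr => ?_
        unfold changeMean
        rcases lt_or_ge r.val z with h | h
        · rw [if_pos h, if_neg h.not_ge]; ring
        · rw [if_neg h.not_gt, if_pos h]; ring
      rw [h1, h2, ← sqrt_mul_div_eq_stepProfile hL hR (by linarith) hRz]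
      field_simp
      ring
    · rw [not_le] at htz
      have h1 : ∑ r ∈ rightSet n t, (if ω r then 1 else 0) * changeMean n z μ₁ μ₂ j r =
          μ₂ j * successCount (rightSet n t) ω := by
        rw [successCount, Finset.mul_sum]
        refine Finset.sum_congr rfl fun r hr => ?_
        have hr' : t ≤ r.val := by simpa [rightSet] using hr
        rw [changeMean, if_neg (by omega : ¬ r.val < z), mul_comm]
      have h2 : ∑ r ∈ leftSet n t, (if ω r then 1 else 0) * changeMean n z μ₁ μ₂ j r =
          μ₂ j * successCount (leftSet n t) ω -
            (μ₂ j - μ₁ j) * successCount (leftSet n z) ω := by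
        have h3 : leftSet n z = (leftSet n t).filter fun r => r.val < z := by
          ext r
          simp only [leftSet, Finset.mem_filter, Finset.mem_univ, true_and]
          omega
        rw [h3, successCount, successCount, Finset.sum_filter, Finset.mul_sum, Finset.mul_sum,
          ← Finset.sum_sub_distrib]
        refine Finset.sum_congr rfl fun r hr => ?_
        unfold changeMean
        rcases lt_or_ge r.val z with h | h
        · rw [if_pos h, if_pos h]; ring
        · rw [if_neg h.not_gt, if_neg h.not_gt]; ring
      rw [h1, h2, ← sqrt_mul_div_eq_stepProfile hR hL (by linarith) hLz,
        mul_comm (successCount (rightSet n t) ω)]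
      field_simp
      ring
  · simp only [if_neg h, zero_mul, Finset.sum_const_zero]
    symm
    apply mul_eq_zero_of_right
    have h0 : successCount (leftSet n t) ω = 0 ∨ successCount (rightSet n t) ω = 0 := by
      by_contra hc
      rw [not_or] at hc
      exact h ⟨lt_of_le_of_ne (successCount_nonneg _ _) (Ne.symm hc.1),
        lt_of_le_of_ne (successCount_nonneg _ _) (Ne.symm hc.2)⟩
    unfold stepProfile
    split_ifs with htz
    · rcases h0 with h0 | h0
      · simp [h0]
      · simp [h0]
    · rcases h0 with h0 | h0
      · simp [h0]
      · simp [h0]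

/-- Multiplying by `r'` turns the difference of ratios into `(m / r) (r' - r) + (m - m')`, so no
lower bound on the denominators enters. -/
theorem mul_abs_div_sub_div_le {m r m' r' x : ℝ} (hm : 0 ≤ m) (hmr : m ≤ r)
    (hm' : 0 ≤ m') (hr' : 0 < r') (h1 : |m - m'| ≤ x) (h2 : |r - r'| ≤ x) :
    r' * |m / r - m' / r'| ≤ 2 * x := by
  have hx : 0 ≤ x := (abs_nonneg _).trans h1
  rcases (hm.trans hmr).eq_or_lt with h | h
  · have hm0 : m = 0 := le_antisymm (hmr.trans h.ge) hm
    rw [hm0, zero_sub, abs_neg, abs_of_nonneg hm'] at h1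
    rw [hm0, zero_div, zero_sub, abs_neg, abs_of_nonneg (by positivity), mul_div_cancel₀ _ hr'.ne']
    linarith
  · have h3 : r' * |m / r - m' / r'| = |m / r * (r' - r) + (m - m')| := by
      nth_rewrite 1 [← abs_of_pos hr']
      rw [← abs_mul]
      congr 1
      field_simp
      ring
    rw [h3]
    refine (abs_add_le _ _).trans ?_
    rw [abs_mul, abs_of_nonneg (div_nonneg hm h.le), abs_sub_comm r' r]
    have : m / r * |r - r'| ≤ 1 * x :=
      mul_le_mul ((div_le_one h).2 hmr) h2 (abs_nonneg _) zero_le_one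
    linarith

/-- Telescope the three factors. Each perturbed ratio carries a spare `√m'`, at most its reference
denominator `√r'` or `√N'`, so the costs are `x`, `2x` and `2x`. -/
theorem abs_stepProfile_sub_le {l N m r l' N' m' r' x : ℝ}
    (hlN : l ≤ N) (hmr : m ≤ r) (hN' : 0 < N') (hr' : 0 < r')
    (hlN' : l' ≤ N') (hmr' : m' ≤ r') (hmN' : m' ≤ N')
    (h1 : |√l - √l'| ≤ x) (h2 : |√N - √N'| ≤ x) (h3 : |√m - √m'| ≤ x) (h4 : |√r - √r'| ≤ x) :
    |stepProfile l N m r - stepProfile l' N' m' r'| ≤ 5 * x := by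
  unfold stepProfile
  have hlN₁ := Real.sqrt_le_sqrt hlN
  have hmr₁ := Real.sqrt_le_sqrt hmr
  have hlN₂ := Real.sqrt_le_sqrt hlN'
  have hmr₂ := Real.sqrt_le_sqrt hmr'
  have hmN₂ := Real.sqrt_le_sqrt hmN'
  have hN₂ := Real.sqrt_pos.2 hN'
  have hr₂ := Real.sqrt_pos.2 hr'
  have k1 := mul_abs_div_sub_div_le (Real.sqrt_nonneg _) hlN₁ (Real.sqrt_nonneg l') hN₂ h1 h2
  have k2 := mul_abs_div_sub_div_le (Real.sqrt_nonneg _) hmr₁ (Real.sqrt_nonneg m') hr₂ h3 h4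
  have e1 : √l / √N ≤ 1 := div_le_one_of_le₀ hlN₁ (Real.sqrt_nonneg _)
  have e2 : √m / √r ≤ 1 := div_le_one_of_le₀ hmr₁ (Real.sqrt_nonneg _)
  have e3 : √m' / √r' ≤ 1 := div_le_one_of_le₀ hmr₂ (Real.sqrt_nonneg _)
  have f1 : 0 ≤ √l / √N := by positivity
  have f2 : 0 ≤ √m / √r := by positivity
  have f3 : 0 ≤ √m' / √r' := by positivity
  have hdec : √l / √N * (√m / √r) * √m - √l' / √N' * (√m' / √r') * √m' =
      √l / √N * (√m / √r) * (√m - √m') + √l / √N * (√m' * (√m / √r - √m' / √r')) +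
        √m' / √r' * (√m' * (√l / √N - √l' / √N')) := by ring
  rw [hdec]
  have b1 : |√l / √N * (√m / √r) * (√m - √m')| ≤ x := by
    rw [abs_mul, abs_of_nonneg (by positivity)]
    exact (mul_le_of_le_one_left (abs_nonneg _) (mul_le_one₀ e1 f2 e2)).trans h3
  have b2 : |√l / √N * (√m' * (√m / √r - √m' / √r'))| ≤ 2 * x := by
    rw [abs_mul, abs_of_nonneg f1, abs_mul, abs_of_nonneg (Real.sqrt_nonneg m')]
    refine (mul_le_of_le_one_left (by positivity) e1).trans (le_trans ?_ k2)
    gcongr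
  have b3 : |√m' / √r' * (√m' * (√l / √N - √l' / √N'))| ≤ 2 * x := by
    rw [abs_mul, abs_of_nonneg f3, abs_mul, abs_of_nonneg (Real.sqrt_nonneg m')]
    refine (mul_le_of_le_one_left (by positivity) e3).trans (le_trans ?_ k1)
    gcongr
  refine (abs_add_le _ _).trans ?_
  have := abs_add_le (√l / √N * (√m / √r) * (√m - √m'))
    (√l / √N * (√m' * (√m / √r - √m' / √r')))
  linarith

theorem stepProfile_mul {q : ℝ} (hq : 0 < q) (l N m r : ℝ) :
    stepProfile (l * q) (N * q) (m * q) (r * q) = √q * stepProfile l N m r := by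
  unfold stepProfile
  have := (Real.sqrt_pos.2 hq).ne'
  rw [Real.sqrt_mul' _ hq.le, Real.sqrt_mul' _ hq.le, Real.sqrt_mul' _ hq.le,
    Real.sqrt_mul' _ hq.le, mul_div_mul_right _ _ this, mul_div_mul_right _ _ this]
  ring

theorem stepProfile_sq {l N m r : ℝ} (hl : 0 ≤ l) (hN : 0 ≤ N) (hm : 0 ≤ m) (hr : 0 ≤ r) :
    stepProfile l N m r ^ 2 = l / N * (m / r) * m := by
  unfold stepProfile
  rw [mul_pow, mul_pow, div_pow, div_pow, Real.sq_sqrt hl, Real.sq_sqrt hN, Real.sq_sqrt hm,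
    Real.sq_sqrt hr]

/-- The CUSUM at time `t` of a unit step after time `z`, for fully observed data. -/
noncomputable def fullProfile (n z t : ℕ) : ℝ :=
  if t ≤ z then stepProfile t n ((n : ℝ) - z) ((n : ℝ) - t)
  else stepProfile ((n : ℝ) - t) n z t

/-- The CUSUM of a unit step after time `z` at the times `1, …, n - 1`. -/
noncomputable def fullProfileVector (n z : ℕ) : EuclideanSpace ℝ (Fin (n - 1)) :=
  WithLp.toLp 2 fun s => fullProfile n z (s.val + 1)

theorem sum_range_cast_succ (N : ℕ) :
    ∑ i ∈ Finset.range N, ((i : ℝ) + 1) = N * (N + 1) / 2 := by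
  induction N with
  | zero => simp
  | succ N ih => rw [Finset.sum_range_succ, ih]; push_cast; ring

/-- Only times on the longer side of the change are kept. There the squared profile dominates a
linear ramp, whose sum is of order `n²`. -/
theorem le_norm_fullProfileVector {n z : ℕ} (hz : 1 ≤ z) (hzn : z < n) :
    n * changeTau n z / 4 ≤ ‖fullProfileVector n z‖ := by
  have hn0 : (0 : ℝ) < n := by exact_mod_cast (by omega : 0 < n)
  have hz0 : (0 : ℝ) < z := by exact_mod_cast hz
  have hzn' : (z : ℝ) + 1 ≤ n := by exact_mod_cast hzn
  have hmin0 : 0 ≤ min (z : ℝ) ((n : ℝ) - z) := le_min hz0.le (by linarith)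
  have hsq : ‖fullProfileVector n z‖ ^ 2 = ∑ i ∈ Finset.range (n - 1), fullProfile n z (i + 1) ^ 2 := by
    rw [← EuclideanSpace.sum_sq]
    exact Fin.sum_univ_eq_sum_range (fun i => fullProfile n z (i + 1) ^ 2) (n - 1)
  rw [changeTau, mul_div_cancel₀ _ hn0.ne']
  apply le_of_sq_le_sq _ (norm_nonneg _)
  rw [hsq]
  rcases le_or_gt n (2 * z) with h | h
  · have h' : (n : ℝ) ≤ 2 * z := by exact_mod_cast h
    have hterm : ∀ i ∈ Finset.range z, ((n : ℝ) - z) ^ 2 / n ^ 2 * ((i : ℝ) + 1) ≤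
        fullProfile n z (i + 1) ^ 2 := by
      intro i hi
      have hi' : i + 1 ≤ z := Finset.mem_range.1 hi
      have hi'' : (i : ℝ) + 1 ≤ z := by exact_mod_cast hi'
      rw [fullProfile, if_pos hi']
      push_cast
      rw [stepProfile_sq (by positivity) hn0.le (by linarith) (by linarith)]
      have : ((n : ℝ) - z) / n ≤ ((n : ℝ) - z) / (n - (i + 1)) :=
        div_le_div_of_nonneg_left (by linarith) (by linarith)
          (by linarith [(Nat.cast_nonneg i : (0 : ℝ) ≤ i)])
      calc ((n : ℝ) - z) ^ 2 / n ^ 2 * ((i : ℝ) + 1) =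
          ((i : ℝ) + 1) / n * (((n : ℝ) - z) / n) * (n - z) := by field_simp
        _ ≤ _ := by gcongr; linarith
    have h1 := Finset.sum_le_sum hterm
    rw [← Finset.mul_sum, sum_range_cast_succ] at h1
    refine le_trans ?_ (h1.trans (Finset.sum_le_sum_of_subset_of_nonneg
      (Finset.range_subset_range.2 (by omega)) fun _ _ _ => sq_nonneg _))
    have h2 : min (z : ℝ) ((n : ℝ) - z) ^ 2 ≤ ((n : ℝ) - z) ^ 2 := by
      gcongr; exact min_le_right _ _
    have h3 : (n : ℝ) ^ 2 ≤ 8 * (z * (z + 1) / 2) := by nlinarith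
    rw [div_mul_eq_mul_div, le_div_iff₀ (by positivity)]
    nlinarith [mul_le_mul h2 h3 (by positivity) (by positivity)]
  · have h' : 2 * (z : ℝ) + 1 ≤ n := by exact_mod_cast h
    -- After reflection `i + 1` is the distance `n - t` to the end. Only `n - 1 - z` times lie after
    -- `z`, which weakens 8 to 16 and fixes the constant `1 / 4`.
    rw [← Finset.sum_range_reflect]
    have hterm : ∀ i ∈ Finset.range (n - 1 - z), (z : ℝ) ^ 2 / n ^ 2 * ((i : ℝ) + 1) ≤
        fullProfile n z (n - 1 - 1 - i + 1) ^ 2 := by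
      intro i hi
      have hi' : i < n - 1 - z := Finset.mem_range.1 hi
      have ht : n - 1 - 1 - i + 1 = n - (i + 1) := by omega
      have hcast : ((n - (i + 1) : ℕ) : ℝ) = n - (i + 1) := by
        rw [Nat.cast_sub (by omega)]; push_cast; ring
      have hi'' : (i : ℝ) + 1 + z + 1 ≤ n := by exact_mod_cast (by omega : i + 1 + z + 1 ≤ n)
      rw [ht, fullProfile, if_neg (by omega), hcast, sub_sub_cancel,
        stepProfile_sq (by positivity) hn0.le hz0.le (by linarith)]
      have : (z : ℝ) / n ≤ (z : ℝ) / (n - (i + 1)) :=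
        div_le_div_of_nonneg_left hz0.le (by linarith)
          (by linarith [(Nat.cast_nonneg i : (0 : ℝ) ≤ i)])
      calc (z : ℝ) ^ 2 / n ^ 2 * ((i : ℝ) + 1) = ((i : ℝ) + 1) / n * ((z : ℝ) / n) * z := by
            field_simp
        _ ≤ _ := by gcongr
    have h1 := Finset.sum_le_sum hterm
    rw [← Finset.mul_sum, sum_range_cast_succ] at h1
    refine le_trans ?_ (h1.trans (Finset.sum_le_sum_of_subset_of_nonneg
      (Finset.range_subset_range.2 (by omega)) fun _ _ _ => sq_nonneg _))
    have hcast : ((n - 1 - z : ℕ) : ℝ) = n - 1 - z := by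
      rw [Nat.cast_sub (by omega), Nat.cast_sub (by omega)]; simp
    rw [hcast]
    have h2 : min (z : ℝ) ((n : ℝ) - z) ^ 2 ≤ (z : ℝ) ^ 2 := by
      gcongr; exact min_le_left _ _
    have h3 : (n : ℝ) ^ 2 ≤ 16 * (((n : ℝ) - 1 - z) * (n - 1 - z + 1) / 2) := by
      have h4 : ((n : ℝ) - 1) / 2 * ((n + 1) / 2) ≤ ((n : ℝ) - 1 - z) * (n - 1 - z + 1) :=
        mul_le_mul (by linarith) (by linarith) (by linarith) (by linarith)
      have hn2 : (2 : ℝ) ≤ n := by exact_mod_cast (by omega : 2 ≤ n)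
      have h5 : (2 : ℝ) * 2 ≤ n * n := mul_le_mul hn2 hn2 zero_le_two hn0.le
      linarith [sq (n : ℝ)]
    rw [div_mul_eq_mul_div, le_div_iff₀ (by positivity)]
    nlinarith [mul_le_mul h2 h3 (by positivity) (by positivity)]

end MissInspect

/-! ### Exceptional events and the final bound. -/

namespace MissInspect

instance {p : ℕ} (n z : ℕ) (μ₁ μ₂ : EuclideanSpace ℝ (Fin p)) (σ : ℝ) (q : Fin p → unitInterval) :
    IsProbabilityMeasure (modelLaw n z μ₁ μ₂ σ q) := by
  unfold modelLaw
  infer_instance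

/-- The event that some entry of the MissCUSUM transformation of the noise exceeds `u`. -/
def largeNoise {p : ℕ} (n z : ℕ) (μ₁ μ₂ : EuclideanSpace ℝ (Fin p)) (u : ℝ) :
    Set ((Fin p → Fin n → ℝ) × (Fin p → Fin n → Bool)) :=
  ⋃ i : Fin p × Fin (n - 1), {x | u < |∑ r, cusumWeight (x.2 i.1) (i.2.val + 1) r *
    (x.1 i.1 r - changeMean n z μ₁ μ₂ i.1 r)|}

/-- The event that, in some row in `J`, the number of entries observed up to (or after) some time
deviates from its mean by more than `x` on the square-root scale. -/
def irregularCounts {p : ℕ} (n : ℕ) (q : Fin p → unitInterval) (J : Finset (Fin p)) (x : ℝ) :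
    Set ((Fin p → Fin n → ℝ) × (Fin p → Fin n → Bool)) :=
  ⋃ j ∈ J, ⋃ i : Fin n,
    {y | x < |√(successCount (leftSet n (i.val + 1)) (y.2 j)) -
        √((leftSet n (i.val + 1)).card * q j)|} ∪
    {y | x < |√(successCount (rightSet n i.val) (y.2 j)) - √((rightSet n i.val).card * q j)|}

section Events

variable {p : ℕ} (n z : ℕ) (μ₁ μ₂ : EuclideanSpace ℝ (Fin p)) (σ : ℝ) (q : Fin p → unitInterval)

theorem measurable_cusum_noise (j : Fin p) (t : ℕ) :
    Measurable fun x : (Fin p → Fin n → ℝ) × (Fin p → Fin n → Bool) =>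
      ∑ r, cusumWeight (x.2 j) t r * (x.1 j r - changeMean n z μ₁ μ₂ j r) := by
  refine Finset.measurable_fun_sum _ fun r _ => Measurable.mul ?_ (by fun_prop)
  exact (measurable_of_countable
    (fun O : Fin p → Fin n → Bool => cusumWeight (O j) t r)).comp measurable_snd

theorem measurableSet_largeNoise (u : ℝ) : MeasurableSet (largeNoise n z μ₁ μ₂ u) :=
  MeasurableSet.iUnion fun i => measurableSet_lt measurable_const
    (measurable_cusum_noise n z μ₁ μ₂ i.1 _).abs

theorem measurableSet_irregularCounts (J : Finset (Fin p)) (x : ℝ) :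
    MeasurableSet (irregularCounts n q J x) := by
  have h : ∀ s : Set (Fin p → Fin n → Bool), MeasurableSet
      {y : (Fin p → Fin n → ℝ) × (Fin p → Fin n → Bool) | y.2 ∈ s} :=
    fun s => measurable_snd s.to_countable.measurableSet
  refine Finset.measurableSet_biUnion _ fun j _ => MeasurableSet.iUnion fun i => ?_
  exact (h {O | x < |√(successCount (leftSet n (i.val + 1)) (O j)) -
      √((leftSet n (i.val + 1)).card * q j)|}).union
    (h {O | x < |√(successCount (rightSet n i.val) (O j)) - √((rightSet n i.val).card * q j)|})

theorem measureReal_cusum_noise_le (j : Fin p) (t : ℕ) {u : ℝ} (hu : 0 ≤ u) :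
    (modelLaw n z μ₁ μ₂ σ q).real {x | u < |∑ r, cusumWeight (x.2 j) t r *
      (x.1 j r - changeMean n z μ₁ μ₂ j r)|} ≤ 2 * Real.exp (-u ^ 2 / (2 * σ ^ 2)) := by
  have hmeas := measurableSet_lt (measurable_const (a := u))
    (measurable_cusum_noise n z μ₁ μ₂ j t).abs
  rw [measureReal_def]
  refine ENNReal.toReal_le_of_le_ofReal (by positivity) ?_
  unfold modelLaw
  -- Conditioning on the mask fixes the weights, and the Gaussian tail is uniform over masks.
  rw [Measure.prod_apply_symm hmeas]
  refine (lintegral_mono (g := fun _ => ENNReal.ofReal (2 * Real.exp (-u ^ 2 / (2 * σ ^ 2))))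
    fun O => ?_).trans (by simp)
  have hrow := (measurePreserving_eval (fun j => Measure.pi fun r =>
      gaussianReal (changeMean n z μ₁ μ₂ j r) (σ ^ 2).toNNReal) j).measure_preimage
    (s := {y : Fin n → ℝ | u < |∑ r, cusumWeight (O j) t r *
      (y r - changeMean n z μ₁ μ₂ j r)|})
    (measurableSet_lt measurable_const (by fun_prop)).nullMeasurableSet
  refine (le_of_eq hrow).trans ?_
  rw [← ofReal_measureReal]
  refine ENNReal.ofReal_le_ofReal ?_
  have := gaussian_linear_tail (changeMean n z μ₁ μ₂ j) (cusumWeight (O j) t) (σ ^ 2).toNNReal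
    (sum_cusumWeight_sq_le_one t (O j)) hu
  rwa [Real.coe_toNNReal _ (sq_nonneg σ)] at this

theorem measureReal_largeNoise_le {u : ℝ} (hu : 0 ≤ u) :
    (modelLaw n z μ₁ μ₂ σ q).real (largeNoise n z μ₁ μ₂ u) ≤
      p * n * (2 * Real.exp (-u ^ 2 / (2 * σ ^ 2))) := by
  refine (measureReal_iUnion_fintype_le _).trans ((Finset.sum_le_sum fun i _ =>
    measureReal_cusum_noise_le n z μ₁ μ₂ σ q i.1 _ hu).trans ?_)
  rw [Finset.sum_const, Finset.card_univ, Fintype.card_prod, Fintype.card_fin, Fintype.card_fin,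
    nsmul_eq_mul]
  push_cast
  gcongr
  omega

theorem measureReal_row_eq (j : Fin p) (s : Set (Fin n → Bool)) :
    (modelLaw n z μ₁ μ₂ σ q).real {y | y.2 j ∈ s} =
      (Measure.pi fun _ : Fin n => bernoulliMeasure true false (q j)).real s := by
  have h1 := measurePreserving_eval
    (fun j => Measure.pi fun _ : Fin n => bernoulliMeasure true false (q j)) j
  have h2 := measurePreserving_snd
    (μ := Measure.pi fun j => Measure.pi fun r =>
      gaussianReal (changeMean n z μ₁ μ₂ j r) (σ ^ 2).toNNReal)
    (ν := Measure.pi fun j => Measure.pi fun _ : Fin n => bernoulliMeasure true false (q j))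
  have h3 := (h1.comp h2).measureReal_preimage (s := s) s.to_countable.measurableSet.nullMeasurableSet
  exact h3

theorem measureReal_irregularCounts_le (hq : ∀ j, 0 < q j) (J : Finset (Fin p)) {x : ℝ}
    (hx : 0 ≤ x) :
    (modelLaw n z μ₁ μ₂ σ q).real (irregularCounts n q J x) ≤
      J.card * (n * (4 * Real.exp (-x ^ 2))) := by
  unfold irregularCounts
  refine (measureReal_biUnion_finset_le _ _).trans
    ((Finset.sum_le_card_nsmul _ _ (n * (4 * Real.exp (-x ^ 2))) fun j _ => ?_).trans_eq
      (nsmul_eq_mul _ _))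
  refine (measureReal_iUnion_fintype_le _).trans
    ((Finset.sum_le_card_nsmul _ _ (4 * Real.exp (-x ^ 2)) fun i _ => ?_).trans_eq (by simp))
  refine (measureReal_union_le _ _).trans ?_
  have h1 := sqrt_successCount_tail (q j) (hq j)
    (A := leftSet n (i.val + 1)) ⟨i, by simp [leftSet]⟩ hx
  have h2 := sqrt_successCount_tail (q j) (hq j)
    (A := rightSet n i.val) ⟨i, by simp [rightSet]⟩ hx
  rw [← measureReal_row_eq n z μ₁ μ₂ σ] at h1 h2
  refine (add_le_add h1 h2).trans_eq (by ring)

end Events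

/-- At the expected counts the profile scales by `√q` (`stepProfile_mul`); this is the origin of the
direction `θ ∘ √q`. -/
theorem abs_stepProfile_counts_sub_le {n z t : ℕ} (hz : 1 ≤ z) (hzn : z < n) (ht : 1 ≤ t)
    (htn : t < n) (ω : Fin n → Bool) {q x : ℝ} (hq : 0 < q)
    (hleft : ∀ i, 1 ≤ i → i ≤ n → |√(successCount (leftSet n i) ω) - √(i * q)| ≤ x)
    (hright : ∀ i, i < n → |√(successCount (rightSet n i) ω) - √(((n : ℝ) - i) * q)| ≤ x) :
    |(if t ≤ z then
        stepProfile (successCount (leftSet n t) ω) (successCount (leftSet n n) ω)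
          (successCount (rightSet n z) ω) (successCount (rightSet n t) ω)
      else stepProfile (successCount (rightSet n t) ω) (successCount (leftSet n n) ω)
          (successCount (leftSet n z) ω) (successCount (leftSet n t) ω)) -
      √q * fullProfile n z t| ≤ 5 * x := by
  have hn0 : (0 : ℝ) < n := by exact_mod_cast (by omega : 0 < n)
  have ht0 : (0 : ℝ) < t := by exact_mod_cast ht
  have htn' : (t : ℝ) < n := by exact_mod_cast htn
  have hzn' : (z : ℝ) < n := by exact_mod_cast hzn
  have hz0 : (0 : ℝ) < z := by exact_mod_cast hz
  have hL := successCount_nonneg (leftSet n t) ω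
  have hR := successCount_nonneg (rightSet n t) ω
  have hN := successCount_left_add_right t ω
  unfold fullProfile
  split_ifs with h
  · have h' : (t : ℝ) ≤ z := by exact_mod_cast h
    rw [← stepProfile_mul hq]
    refine abs_stepProfile_sub_le (by linarith) (successCount_mono ?_ ω) (by positivity)
      (mul_pos (by linarith) hq) (by gcongr) (by gcongr) (by gcongr; linarith)
      (hleft t ht htn.le) (hleft n (by omega) le_rfl) (hright z hzn) (hright t htn)
    intro r
    simp only [rightSet, Finset.mem_filter, Finset.mem_univ, true_and]
    omega
  · have h' : (z : ℝ) ≤ t := by exact_mod_cast (not_le.1 h).le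
    rw [← stepProfile_mul hq]
    refine abs_stepProfile_sub_le (by linarith) (successCount_mono ?_ ω) (by positivity)
      (mul_pos (by linarith) hq) (by gcongr; linarith) (by gcongr) (by gcongr)
      (hright t htn) (hleft n (by omega) le_rfl) (hleft z hz hzn.le) (hleft t ht htn.le)
    intro r
    simp only [leftSet, Finset.mem_filter, Finset.mem_univ, true_and]
    omega

theorem norm_oracleDirection {p : ℕ} (q : Fin p → unitInterval) (θ : EuclideanSpace ℝ (Fin p)) :
    ‖oracleDirection q θ‖ = weightedNorm q θ := by
  rw [EuclideanSpace.norm_eq, weightedNorm]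
  congr 1
  refine Finset.sum_congr rfl fun j _ => ?_
  simp only [oracleDirection, Real.norm_eq_abs, sq_abs, mul_pow]
  rw [Real.sq_sqrt (q j).2.1]

theorem oracleDirection_apply_eq_zero_iff {p : ℕ} {q : Fin p → unitInterval} (hq : ∀ j, 0 < q j)
    (θ : EuclideanSpace ℝ (Fin p)) (j : Fin p) : oracleDirection q θ j = 0 ↔ θ j = 0 := by
  have : √(q j : ℝ) ≠ 0 := (Real.sqrt_pos.2 (by exact_mod_cast hq j)).ne'
  simp [oracleDirection, this]

theorem oracleDirection_ne_zero {p : ℕ} {q : Fin p → unitInterval} (hq : ∀ j, 0 < q j)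
    {θ : EuclideanSpace ℝ (Fin p)} (hθ : θ ≠ 0) : oracleDirection q θ ≠ 0 := by
  intro h
  apply hθ
  ext j
  exact (oracleDirection_apply_eq_zero_iff hq θ j).1 (by rw [h]; rfl)

theorem changeTau_pos {n z : ℕ} (hz : 1 ≤ z) (hzn : z < n) : 0 < changeTau n z := by
  have hz0 : (0 : ℝ) < z := by exact_mod_cast hz
  have hzn' : (z : ℝ) < n := by exact_mod_cast hzn
  exact div_pos (lt_min hz0 (sub_pos.2 hzn')) (by linarith)

/-- The deterministic bound on the angle off the exceptional events. -/
theorem sin_acuteAngle_le_of_notMem {p n z k : ℕ} (hz : 1 ≤ z) (hzn : z < n)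
    {μ₁ μ₂ θ : EuclideanSpace ℝ (Fin p)} (hθ : θ = μ₂ - μ₁) (hθ0 : θ ≠ 0)
    (hk : (Finset.univ.filter fun j => θ j ≠ 0).card ≤ k)
    {q : Fin p → unitInterval} (hq : ∀ j, 0 < q j) {lam u x : ℝ} (hlam : 0 ≤ lam) (hu : 0 ≤ u)
    (hx : 0 ≤ x) (hul : √n * u ≤ lam ∨ √n * u * √p ≤ 2 * (lam * √k))
    {M : Fin p → Fin n → ℝ} {O : Fin p → Fin n → Bool}
    (hnoise : (M, O) ∉ largeNoise n z μ₁ μ₂ u)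
    (hcounts : (M, O) ∉ irregularCounts n q (Finset.univ.filter fun j => θ j ≠ 0) x)
    {v : EuclideanSpace ℝ (Fin p)} {w : EuclideanSpace ℝ (Fin (n - 1))}
    (hvw : IsArgmax (missCUSUM (masked M O) O) lam v w) :
    Real.sin (acuteAngle v (oracleDirection q θ)) ≤
      2 * (3 * (lam * √k) + 5 * x * √n * ‖θ‖) / (weightedNorm q θ * (n * changeTau n z / 4)) := by
  have hn0 : (0 : ℝ) < n := by exact_mod_cast (by omega : 0 < n)
  have hτ := changeTau_pos hz hzn
  have hg := le_norm_fullProfileVector hz hzn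
  have hgpos : 0 < ‖fullProfileVector n z‖ := lt_of_lt_of_le (by positivity) hg
  have hapos := norm_pos_iff.2 (oracleDirection_ne_zero hq hθ0)
  simp only [largeNoise, Set.mem_iUnion, Set.mem_ofPred_eq, not_exists, not_lt] at hnoise
  simp only [irregularCounts, Set.mem_iUnion, Set.mem_union, Set.mem_ofPred_eq, not_exists, not_or,
    not_lt, Finset.mem_filter, Finset.mem_univ, true_and] at hcounts
  set E : Fin p → Fin (n - 1) → ℝ := fun j s =>
    ∑ r, cusumWeight (O j) (s.val + 1) r * (M j r - changeMean n z μ₁ μ₂ j r) with hE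
  set B : Fin p → Fin (n - 1) → ℝ := fun j s =>
    ∑ r, cusumWeight (O j) (s.val + 1) r * changeMean n z μ₁ μ₂ j r -
      oracleDirection q θ j * fullProfileVector n z s with hB
  have hBle : ∀ j s, B j s ^ 2 ≤ θ j ^ 2 * (5 * x) ^ 2 := by
    intro j s
    have hs := s.2
    have hB' : B j s = θ j * ((if s.val + 1 ≤ z then
          stepProfile (successCount (leftSet n (s.val + 1)) (O j)) (successCount (leftSet n n) (O j))
            (successCount (rightSet n z) (O j)) (successCount (rightSet n (s.val + 1)) (O j))
        else stepProfile (successCount (rightSet n (s.val + 1)) (O j))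
            (successCount (leftSet n n) (O j))
            (successCount (leftSet n z) (O j)) (successCount (leftSet n (s.val + 1)) (O j))) -
          √(q j : ℝ) * fullProfile n z (s.val + 1)) := by
      simp only [hB]
      rw [sum_cusumWeight_changeMean, hθ]
      simp only [oracleDirection, fullProfileVector, PiLp.sub_apply]
      ring
    rw [hB', mul_pow]
    by_cases hj : θ j = 0
    · simp [hj]
    · refine mul_le_mul_of_nonneg_left (sq_le_sq' ?_ ?_) (sq_nonneg _)
      all_goals
        have habs := abs_le.1 (abs_stepProfile_counts_sub_le hz hzn (Nat.le_add_left 1 s.val)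
          (by omega) (O j) (q := q j) (x := x) (by exact_mod_cast hq j)
          (fun i hi hin => by
            have := (hcounts j hj ⟨i - 1, by omega⟩).1
            simp only [Nat.sub_add_cancel hi] at this
            rwa [card_leftSet hin] at this)
          (fun i hin => by
            have := (hcounts j hj ⟨i, hin⟩).2
            rwa [card_rightSet hin.le, Nat.cast_sub hin.le] at this))
      · linarith [habs.1]
      · exact habs.2
  have hcard : ((n - 1 : ℕ) : ℝ) ≤ n := by exact_mod_cast Nat.sub_le n 1
  have hmain := sin_acuteAngle_le_of_isArgmax (a := oracleDirection q θ)
    (g := fullProfileVector n z) (missCUSUM (masked M O) O) E B (lam := lam) (kap := √n * u)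
    (b := 5 * x * √n * ‖θ‖) (k := k) (v := v) (w := w) hlam (by positivity) (by positivity)
    (norm_pos_iff.1 hapos) (norm_pos_iff.1 hgpos) (fun j s => by
      have hs := s.2
      rw [missCUSUM_masked, missCUSUM, missCUSUMEntry_eq_sum (by omega)]
      simp only [hE, hB, mul_sub, Finset.sum_sub_distrib]
      ring)
    (by simpa only [ne_eq, oracleDirection_apply_eq_zero_iff hq] using hk)
    (fun j => by
      refine (Finset.sum_le_card_nsmul _ _ (u ^ 2) fun s _ =>
        sq_le_sq' (abs_le.1 (hnoise (j, s))).1 (abs_le.1 (hnoise (j, s))).2).trans ?_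
      rw [Finset.card_univ, Fintype.card_fin, nsmul_eq_mul, mul_pow, Real.sq_sqrt hn0.le]
      gcongr)
    hul
    (by
      refine (Finset.sum_le_sum fun j _ => Finset.sum_le_sum fun s _ => hBle j s).trans ?_
      simp only [Finset.sum_const, Finset.card_univ, Fintype.card_fin, nsmul_eq_mul,
        ← Finset.mul_sum, ← Finset.sum_mul, EuclideanSpace.sum_sq]
      have : (5 * x * √n * ‖θ‖) ^ 2 = n * (‖θ‖ ^ 2 * (5 * x) ^ 2) := by
        rw [mul_pow, mul_pow, Real.sq_sqrt hn0.le]; ring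
      rw [this]
      gcongr)
    hvw
  refine hmain.trans ?_
  rw [← norm_oracleDirection]
  gcongr

/-- Use `p log (k / p) ≤ k - p` and `log (p n) ≥ 1 / 2`. -/
theorem mul_log_le_of_le {p k n : ℝ} (hp : 1 ≤ p) (hn : 2 ≤ n) (hpk : p ≤ k) :
    p * Real.log (k * n) ≤ 2 * k * Real.log (p * n) := by
  have hp0 : 0 < p := by linarith
  have hn0 : 0 < n := by linarith
  have hk0 : 0 < k := by linarith
  have h1 : Real.log (k * n) = Real.log (k / p) + Real.log (p * n) := by
    rw [← Real.log_mul (by positivity) (by positivity)]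
    congr 1
    field_simp
  have h2 := Real.log_le_sub_one_of_pos (div_pos hk0 hp0)
  have h3 : 1 / 2 ≤ Real.log (p * n) := by
    have : Real.log 2 ≤ Real.log (p * n) := Real.log_le_log (by norm_num) (by nlinarith)
    linarith [Real.log_two_gt_d9]
  have h4 : p * (k / p) = k := mul_div_cancel₀ _ hp0.ne'
  rw [h1]
  nlinarith [mul_le_mul_of_nonneg_left h2 hp0.le, mul_le_mul_of_nonneg_left h3 (sub_nonneg.2 hpk)]

/-- Since `k` may exceed `p`, the noise level uses `max p k` to keep the failure probability of
order `1 / (k n)`. The two alternatives are those of the perturbation bound. -/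
theorem noise_level_le {p n k : ℕ} (hp : 1 ≤ p) (hn : 2 ≤ n) {σ lam : ℝ} (hσ : 0 < σ)
    (hlam : 2 * σ * √(n * Real.log (p * n)) ≤ lam) :
    √n * (2 * σ * √(Real.log ((max p k : ℕ) * n))) ≤ lam ∨
      √n * (2 * σ * √(Real.log ((max p k : ℕ) * n))) * √p ≤ 2 * (lam * √k) := by
  have hn0 : (0 : ℝ) ≤ n := Nat.cast_nonneg n
  rw [Real.sqrt_mul hn0] at hlam
  rcases le_or_gt k p with h | h
  · left
    rw [max_eq_left h]
    linarith
  · right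
    rw [max_eq_right h.le]
    have h1 := mul_log_le_of_le (p := p) (k := k) (n := n) (by exact_mod_cast hp)
      (by exact_mod_cast hn) (by exact_mod_cast h.le)
    have h2 : √p * √(Real.log (k * n)) ≤ 2 * (√k * √(Real.log (p * n))) := by
      rw [← Real.sqrt_mul (Nat.cast_nonneg _), ← Real.sqrt_mul (Nat.cast_nonneg _)]
      refine Real.sqrt_le_iff.2 ⟨by positivity, ?_⟩
      have hlog : 0 ≤ Real.log (p * n : ℝ) := by
        have : (0 : ℝ) ≤ Real.log ((p * n : ℕ) : ℝ) := Real.log_natCast_nonneg _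
        simpa using this
      rw [mul_pow, Real.sq_sqrt (by positivity)]
      nlinarith [mul_nonneg (Nat.cast_nonneg k : (0 : ℝ) ≤ k) hlog]
    calc √n * (2 * σ * √(Real.log (k * n))) * √p
        = √n * (2 * σ) * (√p * √(Real.log (k * n))) := by ring
      _ ≤ √n * (2 * σ) * (2 * (√k * √(Real.log (p * n)))) := by gcongr
      _ = 2 * ((2 * σ * (√n * √(Real.log (p * n)))) * √k) := by ring
      _ ≤ 2 * (lam * √k) := by gcongr

theorem exp_neg_two_mul_log {y : ℝ} (hy : 0 < y) : Real.exp (-(2 * Real.log y)) = 1 / y ^ 2 := by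
  rw [Real.exp_neg, two_mul, Real.exp_add, Real.exp_log hy, one_div, sq]

end MissInspect

open MissInspect in
/-- The event `E` makes the probability bound meaningful for an arbitrary, possibly
non-measurable, choice of maximisers. -/
theorem proposition1 {S : Type*} [MeasurableSpace S] (P : Measure S) [IsProbabilityMeasure P]
    (p n z k : ℕ) (hz : 1 ≤ z) (hzn : z < n)
    (μ₁ μ₂ θ : EuclideanSpace ℝ (Fin p)) (hθ : θ = μ₂ - μ₁) (hθ0 : θ ≠ 0)
    (hk : (Finset.univ.filter fun j => θ j ≠ 0).card ≤ k)
    (σ : ℝ) (hσ : 0 < σ) (q : Fin p → unitInterval) (hq : ∀ j, 0 < q j)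
    (X : S → Fin p → Fin n → ℝ) (O : S → Fin p → Fin n → Bool)
    (hXO : HasLaw (fun s => (X s, O s)) (MissInspect.modelLaw n z μ₁ μ₂ σ q) P)
    (lam : ℝ) (hlam : 2 * σ * √(n * Real.log (p * n)) ≤ lam)
    (v : S → EuclideanSpace ℝ (Fin p)) (w : S → EuclideanSpace ℝ (Fin (n - 1)))
    (hvw : ∀ s, MissInspect.IsArgmax
      (MissInspect.missCUSUM (MissInspect.masked (X s) (O s)) (O s)) lam (v s) (w s)) :
    ∃ E : Set S, MeasurableSet E ∧ 1 - 6 / ((k : ℝ) * n) ≤ P.real E ∧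
      ∀ s ∈ E,
        Real.sin (MissInspect.acuteAngle (v s) (MissInspect.oracleDirection q θ)) ≤
          32 * lam * √k / (n * MissInspect.changeTau n z * MissInspect.weightedNorm q θ) +
          112 * ‖θ‖ / (MissInspect.changeTau n z * MissInspect.weightedNorm q θ) *
            √(6 * Real.log (k * n) / n) := by
  obtain ⟨j₀, hj₀⟩ : ∃ j, θ j ≠ 0 := by
    by_contra! h
    exact hθ0 (by ext j; exact h j)
  have hp1 : 1 ≤ p := Nat.one_le_iff_ne_zero.2 (by rintro rfl; exact j₀.elim0)
  have hk1 : 1 ≤ k := le_trans (Finset.card_pos.2 ⟨j₀, by simpa using hj₀⟩) hk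
  have hn0 : (0 : ℝ) < n := by exact_mod_cast (by omega : 0 < n)
  have hk0 : (0 : ℝ) < k := by exact_mod_cast hk1
  have hp0 : (0 : ℝ) < p := by exact_mod_cast hp1
  have hlam0 : 0 ≤ lam := le_trans (by positivity) hlam
  have hlog : 0 ≤ Real.log (k * n : ℝ) := by
    have : (0 : ℝ) ≤ Real.log ((k * n : ℕ) : ℝ) := Real.log_natCast_nonneg _
    simpa using this
  set K : ℕ := max p k with hK
  have hKk : (k : ℝ) ≤ K := by exact_mod_cast le_max_right p k
  have hKp : (p : ℝ) ≤ K := by exact_mod_cast le_max_left p k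
  have hlogK : 0 ≤ Real.log (K * n : ℝ) := by
    have : (0 : ℝ) ≤ Real.log ((K * n : ℕ) : ℝ) := Real.log_natCast_nonneg _
    simpa using this
  -- These levels give each noise entry tail `2 / (K n)²` and each count tail `2 / (k n)²`. The
  -- union bounds contribute `2 / (k n)` and `4 / (k n)`.
  set u := 2 * σ * √(Real.log (K * n)) with hu
  set x := √(2 * Real.log (k * n)) with hx
  have hu0 : 0 ≤ u := by positivity
  have hx0 : 0 ≤ x := Real.sqrt_nonneg _
  set bad := largeNoise n z μ₁ μ₂ u ∪
    irregularCounts n q (Finset.univ.filter fun j => θ j ≠ 0) x with hbad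
  have hmeas : MeasurableSet bad := (measurableSet_largeNoise n z μ₁ μ₂ u).union
    (measurableSet_irregularCounts n q _ x)
  have hprob : (modelLaw n z μ₁ μ₂ σ q).real bad ≤ 6 / (k * n) := by
    have h1 := measureReal_largeNoise_le n z μ₁ μ₂ σ q hu0
    have h2 := measureReal_irregularCounts_le n z μ₁ μ₂ σ q hq
      (Finset.univ.filter fun j => θ j ≠ 0) hx0
    have e1 : -u ^ 2 / (2 * σ ^ 2) = -(2 * Real.log (K * n)) := by
      rw [hu, mul_pow, Real.sq_sqrt hlogK]
      field_simp
    rw [e1, exp_neg_two_mul_log (by positivity)] at h1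
    rw [hx, Real.sq_sqrt (by positivity), exp_neg_two_mul_log (by positivity)] at h2
    have h1' : (p : ℝ) * n * (2 * (1 / (K * n) ^ 2)) ≤ 2 / (k * n) := by
      calc (p : ℝ) * n * (2 * (1 / (K * n) ^ 2)) ≤
          (K : ℝ) * n * (2 * (1 / (K * n) ^ 2)) := by gcongr
        _ = 2 / ((K : ℝ) * n) := by
          have : (0 : ℝ) < K := hk0.trans_le hKk
          field_simp
        _ ≤ 2 / ((k : ℝ) * n) := by gcongr
    have h2' : ((Finset.univ.filter fun j => θ j ≠ 0).card : ℝ) *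
        (n * (4 * (1 / (k * n) ^ 2))) ≤ 4 / (k * n) := by
      calc _ ≤ (k : ℝ) * (n * (4 * (1 / (k * n) ^ 2))) := by gcongr
        _ = 4 / (k * n) := by field_simp
    calc _ ≤ _ := measureReal_union_le _ _
      _ ≤ 2 / (k * n) + 4 / ((k : ℝ) * n) := add_le_add (h1.trans h1') (h2.trans h2')
      _ = 6 / (k * n) := by ring
  -- The data are only a.e. measurable, so the good event is shrunk to a measurable set of equal
  -- measure.
  have hnull : NullMeasurableSet ((fun s => (X s, O s)) ⁻¹' badᶜ) P :=
    hXO.aemeasurable.nullMeasurable hmeas.compl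
  obtain ⟨E, hEsub, hEmeas, hEeq⟩ := hnull.exists_measurable_subset_ae_eq
  refine ⟨E, hEmeas, ?_, fun s hs => ?_⟩
  · rw [measureReal_congr hEeq, measureReal_def,
      ← Measure.map_apply_of_aemeasurable hXO.aemeasurable hmeas.compl, hXO.map_eq,
      ← measureReal_def, probReal_compl_eq_one_sub hmeas]
    linarith
  · have hgood : (X s, O s) ∉ bad := hEsub hs
    rw [hbad, Set.mem_union, not_or] at hgood
    refine (sin_acuteAngle_le_of_notMem hz hzn hθ hθ0 hk hq hlam0 hu0 hx0
      (noise_level_le hp1 (by omega) hσ hlam) hgood.1 hgood.2 (hvw s)).trans ?_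
    have hτ := changeTau_pos hz hzn
    have hW : 0 < weightedNorm q θ := by
      rw [← norm_oracleDirection]
      exact norm_pos_iff.2 (oracleDirection_ne_zero hq hθ0)
    have hxn : x * √n ≤ n * √(6 * Real.log (k * n) / n) := by
      rw [hx, ← Real.sqrt_mul (by positivity)]
      refine Real.sqrt_le_iff.2 ⟨by positivity, ?_⟩
      rw [mul_pow, Real.sq_sqrt (by positivity)]
      have : (n : ℝ) ^ 2 * (6 * Real.log (k * n) / n) = 6 * (Real.log (k * n) * n) := by
        field_simp
      rw [this]
      nlinarith [mul_nonneg hlog hn0.le]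
    set y := √(6 * Real.log (k * n) / n) with hy
    have hy0 : 0 ≤ y := Real.sqrt_nonneg _
    -- Over this common denominator the bound needs only 6 and 10 in place of 8 and 28.
    have hrhs : 32 * lam * √k / (n * changeTau n z * weightedNorm q θ) +
        112 * ‖θ‖ / (changeTau n z * weightedNorm q θ) * y =
        (8 * (lam * √k) + 28 * (‖θ‖ * (n * y))) / (weightedNorm q θ * (n * changeTau n z / 4)) := by
      field_simp
      ring
    rw [hrhs]
    gcongr
    have h1 := mul_le_mul_of_nonneg_left hxn (norm_nonneg θ)
    have h2 : 0 ≤ lam * √k := by positivity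
    have h3 : 0 ≤ ‖θ‖ * (n * y) := by positivity
    nlinarith
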